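/- Let $\mathbb{X}$ be a semi-abelian category (pointed, Barr-exact, protomodular, with binary coproducts) and let $n\ge 0$. A short exact sequence $0\to K\xrightarrow{k}X\xrightarrow{p}Y\to 0$ is a pair with $k=\ker p$ and $p=\operatorname{coker}k$; a torsion theory $(\mathcal T,\mathcal F)$ is a pair of full replete subcategories such that every morphism from an object of $\mathcal T$ to an object of $\mathcal F$ is zero and every object $X$ admits a short exact sequence $0\to T_X\to X\to F_X\to 0$ with $T_X\in\mathcal T$, $F_X\in\mathcal F$ (unique up to isomorphism). For a simplicial object $X$ let $N(X)$ be its Moore complex, $N(X)_0=X_0$, $N(X)_m=\bigcap_{i=0}^{m-1}\ker(d_i:X_m\to X_{m-1})$ with differential $\delta_m$ induced by $d_m$ and $N(X)_m=0$ for $m<0$; this gives a functor $N:\mathrm{Simp}(\mathbb X)\to ch(\mathbb X)$ into the $\mathbb Z$-indexed chain complexes. Let $tr_n\dashv cosk_n$ be the $n$-truncation and $n$-coskeleton of simplicial objects and put $\mathcal T_{tr_n}=\{X\mid tr_n(X)\cong 0\}$, $\mathcal F_{tr_n}=\{X\mid \text{the unit } X\to cosk_n\,tr_n(X)\text{ is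 monic}\}$. Let $pch(\mathbb X)$ be the full subcategory of proper chain complexes, i.e. those in which every differential is a normal epimorphism followed by a normal monomorphism; a short exact sequence in $pch(\mathbb X)$ is one in $ch(\mathbb X)$ whose objects are proper. Put $pch(\mathbb X)_{\ge n+1}=\{M\in pch(\mathbb X)\mid M_i=0 \text{ for } i<n+1\}$ and $\mathcal{MN}_{n+1}=\{M\in pch(\mathbb X)\mid \delta_{n+1}\text{ is a normal monomorphism and } M_i=0 \text{ for } i>n+1\}$. Then $\mu_{\ge n+1}=(\mathcal T_{tr_n},\mathcal F_{tr_n})$ is a torsion theory in $\mathrm{Simp}(\mathbb X)$, $\mathcal{KER}_{n+1}=(pch(\mathbb X)_{\ge n+1},\mathcal{MN}_{n+1})$ is a torsion theory in $pch(\mathbb X)$, the functor $N$ takes values in $pch(\mathbb X)$, and: (1) if $0\to T\to X\to F\to 0$ is the short exact sequence of a simplicial object $X$ given by $\mu_{\ge n+1}$, then $0\to N(T)\to N(X)\to N(F)\to 0$ is the short exact sequence of $N(X)$ given by $\mathcal{KER}_{n+1}$; (2) $N$ maps $\mathcal T_{tr_n}$ into $pch(\mathbb X)_{\ge n+1}$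 and $\mathcal F_{tr_n}$ into $\mathcal{MN}_{n+1}$. -/

import Mathlib

open CategoryTheory CategoryTheory.Limits Opposite
open scoped Simplicial

universe v u

namespace SemiAb

/-! ### Semi-abelian categories -/

section SemiAbelian

/-- Protomodularity in the sense of Bourn: for every `f : E ⟶ B`, the change-of-base functor
`f^* : Pt_B ⥤ Pt_E` between the categories of points (split epimorphisms with a chosen section)
reflects isomorphisms. Here `(p, s)` and `(p', s')` are points over `B`, `g` is a morphism of points
from `(p, s)` to `(p', s')`, and `h` is the morphism induced by `g` between their pullbacks along
`f`. (A morphism of points is invertible if and only if its underlying morphism is.) -/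
class Protomodular (C : Type u) [Category.{v} C] : Prop where
  isIso_of_pullback {E B A A' P P' : C} (f : E ⟶ B)
    (p : A ⟶ B) (s : B ⟶ A) (_ : s ≫ p = 𝟙 B)
    (p' : A' ⟶ B) (s' : B ⟶ A') (_ : s' ≫ p' = 𝟙 B)
    (g : A ⟶ A') (_ : g ≫ p' = p) (_ : s ≫ g = s')
    (a : P ⟶ A) (q : P ⟶ E) (_ : IsPullback a q p f)
    (a' : P' ⟶ A') (q' : P' ⟶ E) (_ : IsPullback a' q' p' f)
    (h : P ⟶ P') (_ : h ≫ a' = a ≫ g) (_ : h ≫ q' = q) (_ : IsIso h) : IsIso g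

/-- A regular category is (Barr-)exact if every internal equivalence relation is the kernel pair
of some morphism. -/
class BarrExact (C : Type u) [Category.{v} C] : Prop extends Regular C where
  exists_isKernelPair {R X : C} (p₁ p₂ : R ⟶ X) (_ : IsEquivalenceRelation p₁ p₂) :
    ∃ (Y : C) (f : X ⟶ Y), IsKernelPair f p₁ p₂

/-- A semi-abelian category: pointed, exact, protomodular, with binary coproducts. The zero
morphisms of a pointed category are unique, so that they may be given beforehand. -/
class SemiAbelian (C : Type u) [Category.{v} C] [HasZeroMorphisms C] : Prop extends
  HasZeroObject C, BarrExact C, Protomodular C, HasBinaryCoproducts C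

end SemiAbelian

/-! ### Short exact sequences and torsion theories -/

section Torsion

variable {A : Type u} [Category.{v} A] [HasZeroMorphisms A]

/-- `0 ⟶ K ⟶ X ⟶ Y ⟶ 0` is short exact: `k` is the kernel of `p` and `p` is the cokernel
of `k`. -/
def IsShortExact {K X Y : A} (k : K ⟶ X) (p : X ⟶ Y) : Prop :=
  ∃ w : k ≫ p = 0, Nonempty (IsLimit (KernelFork.ofι k w)) ∧
    Nonempty (IsColimit (CokernelCofork.ofπ p w))

/-- The sequence `0 ⟶ K ⟶ X ⟶ Y ⟶ 0` is a short exact sequence with `K` in `T` and `Y` in `F`,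
i.e. it is (up to isomorphism) the short exact sequence of the object `X` given by the torsion
theory `(T, F)`. -/
structure IsTorsionSequence (T F : ObjectProperty A) {K X Y : A} (k : K ⟶ X) (p : X ⟶ Y) :
    Prop where
  torsion : T K
  torsionFree : F Y
  shortExact : IsShortExact k p

/-- `(T, F)` is a torsion theory in the full subcategory `P` of `A`, where a short exact sequence in
`P` is a short exact sequence in `A` all of whose objects belong to `P`. For a torsion theory in `A`
itself, take `P = ⊤`. -/
structure IsTorsionTheory (P T F : ObjectProperty A) : Prop where
  torsion_le : T ≤ P
  torsionFree_le : F ≤ P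
  torsion_replete : T.IsClosedUnderIsomorphisms
  torsionFree_replete : F.IsClosedUnderIsomorphisms
  eq_zero {X Y : A} (f : X ⟶ Y) (_ : T X) (_ : F Y) : f = 0
  exists_sequence (X : A) (_ : P X) :
    ∃ (K Y : A) (k : K ⟶ X) (p : X ⟶ Y), IsTorsionSequence T F k p

end Torsion

/-! ### Proper chain complexes and the torsion theories `KER n` -/

section Chain

variable {C : Type u} [Category.{v} C] [HasZeroMorphisms C]

/-- A morphism is proper if the monic part of its normal epi/mono factorization is a normal
monomorphism. -/
def IsProper {X Y : C} (f : X ⟶ Y) : Prop :=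
  ∃ (I : C) (e : X ⟶ I) (m : I ⟶ Y),
    Nonempty (NormalEpi e) ∧ Nonempty (NormalMono m) ∧ e ≫ m = f

variable (C)

/-- The proper chain complexes, as a full subcategory of the (`ℤ`-indexed) chain complexes. -/
def pch : ObjectProperty (ChainComplex C ℤ) := fun M =>
  ∀ i : ℤ, IsProper (M.d i (i - 1))

/-- The proper chain complexes `M` with `M_i = 0` for `i < n`. -/
def pchGE (n : ℤ) : ObjectProperty (ChainComplex C ℤ) := fun M =>
  pch C M ∧ ∀ i : ℤ, i < n → IsZero (M.X i)

/-- The proper chain complexes `M` such that `δ_n : M_n ⟶ M_{n-1}` is a normal monomorphism and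
`M_i = 0` for `i > n`. The pair `(pchGE C n, MN C n)` is the torsion theory `KER_n`. -/
def MN (n : ℤ) : ObjectProperty (ChainComplex C ℤ) := fun M =>
  pch C M ∧ Nonempty (NormalMono (M.d n (n - 1))) ∧ ∀ i : ℤ, n < i → IsZero (M.X i)

end Chain

/-! ### The Moore normalization -/

section Moore

variable {C : Type u} [Category.{v} C] [HasZeroMorphisms C] [HasFiniteLimits C]

namespace Moore

open CategoryTheory.Subobject

/-- `N(X)_n`, the intersection of the kernels of `d_0, …, d_{n-1} : X_n ⟶ X_{n-1}`. -/
noncomputable def objX (X : SimplicialObject C) (n : ℕ) : Subobject (X _⦋n⦌) :=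
  match n with
  | 0 => ⊤
  | n + 1 => Finset.univ.inf fun k : Fin (n + 1) => kernelSubobject (X.δ k.castSucc)

theorem objX_arrow_δ (X : SimplicialObject C) (n : ℕ) (k : Fin (n + 1)) :
    (objX X (n + 1)).arrow ≫ X.δ k.castSucc = 0 := by
  change (Finset.univ.inf fun k : Fin (n + 1) => kernelSubobject (X.δ k.castSucc)).arrow ≫ _ = 0
  rw [← factorThru_arrow _ _ (finset_inf_arrow_factors Finset.univ
    (fun k : Fin (n + 1) => kernelSubobject (X.δ k.castSucc)) k (by simp))]
  erw [Category.assoc, kernelSubobject_arrow_comp, comp_zero]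

theorem objX_factors (X : SimplicialObject C) {Z : C} {n : ℕ} (f : Z ⟶ X _⦋n + 1⦌)
    (hf : ∀ k : Fin (n + 1), f ≫ X.δ k.castSucc = 0) : (objX X (n + 1)).Factors f :=
  (finset_inf_factors _).mpr fun k _ => kernelSubobject_factors _ _ (hf k)

theorem objD_factors (X : SimplicialObject C) (n : ℕ) :
    (objX X n).Factors ((objX X (n + 1)).arrow ≫ X.δ (Fin.last (n + 1))) :=
  match n with
  | 0 => top_factors _
  | n + 1 => objX_factors X _ fun k => by
      rw [Category.assoc, ← Fin.succ_last, X.δ_comp_δ (Fin.le_last _)]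
      erw [reassoc_of% (objX_arrow_δ X (n + 1) k.castSucc)]
      exact zero_comp

/-- The differential `N(X)_{n+1} ⟶ N(X)_n`, the restriction of `d_{n+1} : X_{n+1} ⟶ X_n`. -/
noncomputable def objD (X : SimplicialObject C) (n : ℕ) :
    (objX X (n + 1) : C) ⟶ (objX X n : C) :=
  (objX X n).factorThru ((objX X (n + 1)).arrow ≫ X.δ (Fin.last (n + 1))) (objD_factors X n)

theorem objD_arrow (X : SimplicialObject C) (n : ℕ) :
    objD X n ≫ (objX X n).arrow = (objX X (n + 1)).arrow ≫ X.δ (Fin.last (n + 1)) :=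
  factorThru_arrow _ _ _

theorem objD_comp_objD (X : SimplicialObject C) (n : ℕ) : objD X (n + 1) ≫ objD X n = 0 := by
  rw [← cancel_mono (objX X n).arrow, Category.assoc, objD_arrow, ← Category.assoc, objD_arrow,
    Category.assoc, zero_comp]
  have h := X.δ_comp_δ_self (i := Fin.last (n + 1))
  rw [Fin.succ_last] at h
  rw [← h]
  erw [reassoc_of% (objX_arrow_δ X (n + 1) (Fin.last (n + 1)))]
  exact zero_comp

theorem map_factors {X Y : SimplicialObject C} (f : X ⟶ Y) (n : ℕ) :
    (objX Y n).Factors ((objX X n).arrow ≫ f.app (op ⦋n⦌)) :=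
  match n with
  | 0 => top_factors _
  | n + 1 => objX_factors Y _ fun k => by
      have h := SimplicialObject.δ_naturality f k.castSucc
      rw [Category.assoc, ← h, reassoc_of% (objX_arrow_δ X n k), zero_comp]

/-- The morphism `N(X)_n ⟶ N(Y)_n` induced by `f : X ⟶ Y`. -/
noncomputable def mapX {X Y : SimplicialObject C} (f : X ⟶ Y) (n : ℕ) :
    (objX X n : C) ⟶ (objX Y n : C) :=
  (objX Y n).factorThru ((objX X n).arrow ≫ f.app (op ⦋n⦌)) (map_factors f n)

theorem mapX_arrow {X Y : SimplicialObject C} (f : X ⟶ Y) (n : ℕ) :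
    mapX f n ≫ (objX Y n).arrow = (objX X n).arrow ≫ f.app (op ⦋n⦌) :=
  factorThru_arrow _ _ _

theorem mapX_objD {X Y : SimplicialObject C} (f : X ⟶ Y) (n : ℕ) :
    mapX f (n + 1) ≫ objD Y n = objD X n ≫ mapX f n := by
  rw [← cancel_mono (objX Y n).arrow, Category.assoc, Category.assoc, objD_arrow, mapX_arrow,
    ← Category.assoc, mapX_arrow, ← Category.assoc, objD_arrow, Category.assoc, Category.assoc,
    SimplicialObject.δ_naturality]

theorem mapX_id (X : SimplicialObject C) (n : ℕ) : mapX (𝟙 X) n = 𝟙 _ := by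
  rw [← cancel_mono (objX X n).arrow, mapX_arrow]
  simp

theorem mapX_comp {X Y Z : SimplicialObject C} (f : X ⟶ Y) (g : Y ⟶ Z) (n : ℕ) :
    mapX (f ≫ g) n = mapX f n ≫ mapX g n := by
  rw [← cancel_mono (objX Z n).arrow, mapX_arrow, Category.assoc, mapX_arrow, ← Category.assoc,
    mapX_arrow]
  simp

end Moore

variable (C)

/-- The Moore normalization as an `ℕ`-indexed chain complex. -/
noncomputable def mooreNat : SimplicialObject C ⥤ ChainComplex C ℕ where
  obj X := ChainComplex.of (fun n => (Moore.objX X n : C)) (Moore.objD X) (Moore.objD_comp_objD X)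
  map f := ChainComplex.ofHom (fun n => Moore.mapX f n) (fun n => by
    simp only [ChainComplex.of_d]
    exact Moore.mapX_objD f n)
  map_id X := by
    refine HomologicalComplex.hom_ext _ _ fun n => ?_
    exact Moore.mapX_id X n
  map_comp f g := by
    refine HomologicalComplex.hom_ext _ _ fun n => ?_
    exact Moore.mapX_comp f g n

/-- The inclusion of the shape of `ℕ`-indexed chain complexes into that of `ℤ`-indexed ones. -/
def natToInt : (ComplexShape.down ℕ).Embedding (ComplexShape.down ℤ) where
  f n := (n : ℤ)
  injective_f _ _ h := by simpa using h
  rel {i j} h := by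
    simp only [ComplexShape.down_Rel] at h ⊢
    lia

instance : natToInt.IsRelIff where
  rel' i j h := by
    simp only [ComplexShape.down_Rel, natToInt] at h ⊢
    lia

/-- The Moore normalization functor `N : Simp(C) ⥤ ch(C)`, with `N(X)_i = 0` for `i < 0`. -/
noncomputable def moore [HasZeroObject C] : SimplicialObject C ⥤ ChainComplex C ℤ :=
  mooreNat C ⋙ natToInt.extendFunctor C

end Moore

/-! ### The torsion theories `μ_{≥ n+1}` of simplicial objects -/

section Simplicial

instance finite_truncated (n : ℕ) : Finite (SimplexCategory.Truncated n) :=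
  Finite.of_injective
    (fun a : SimplexCategory.Truncated n => (⟨a.obj.len, Nat.lt_succ_of_le a.property⟩ : Fin (n + 1)))
    (fun a b h => by
      obtain ⟨a, ha⟩ := a
      obtain ⟨b, hb⟩ := b
      have : a = b := SimplexCategory.ext (by simpa using h)
      subst this
      rfl)

instance finite_truncated_hom (n : ℕ) (a b : SimplexCategory.Truncated n) : Finite (a ⟶ b) :=
  Finite.of_injective (fun f => (SimplexCategory.Truncated.inclusion n).map f)
    (SimplexCategory.Truncated.inclusion n).map_injective

instance finite_structuredArrow (n : ℕ) (X : SimplexCategoryᵒᵖ) :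
    Finite (StructuredArrow X (SimplexCategory.Truncated.inclusion n).op) := by
  have (Y : (SimplexCategory.Truncated n)ᵒᵖ) :
      Finite (X ⟶ (SimplexCategory.Truncated.inclusion n).op.obj Y) :=
    Finite.of_equiv _ (opEquiv _ _).symm
  have : Finite (SimplexCategory.Truncated n)ᵒᵖ := Finite.of_equiv _ equivToOpposite
  refine Finite.of_injective
    (β := Σ Y : (SimplexCategory.Truncated n)ᵒᵖ,
      (X ⟶ (SimplexCategory.Truncated.inclusion n).op.obj Y))
    (fun f => ⟨f.right, f.hom⟩) ?_
  rintro ⟨⟨⟨⟩⟩, Y, f⟩ ⟨⟨⟨⟩⟩, Z, g⟩ h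
  simp only [Sigma.mk.injEq] at h
  obtain ⟨rfl, h⟩ := h
  cases h
  rfl

instance finite_structuredArrow_hom (n : ℕ) (X : SimplexCategoryᵒᵖ)
    (f g : StructuredArrow X (SimplexCategory.Truncated.inclusion n).op) : Finite (f ⟶ g) := by
  have : Finite (f.right ⟶ g.right) := Finite.of_equiv _ (opEquiv _ _).symm
  exact Finite.of_injective (fun a => a.right) (fun a b h => StructuredArrow.ext a b h)

/-- In a category with finite limits, the `n`-coskeleton functors exist. -/
instance hasRightKanExtension {C : Type u} [Category.{v} C] [HasFiniteLimits C] (n : ℕ)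
    (F : (SimplexCategory.Truncated n)ᵒᵖ ⥤ C) :
    (SimplexCategory.Truncated.inclusion n).op.HasRightKanExtension F := by
  have (X : SimplexCategoryᵒᵖ) :
      HasLimitsOfShape (StructuredArrow X (SimplexCategory.Truncated.inclusion n).op) C := by
    let _ : FinCategory (StructuredArrow X (SimplexCategory.Truncated.inclusion n).op) :=
      { fintypeObj := Fintype.ofFinite _
        fintypeHom := fun _ _ => Fintype.ofFinite _ }
    infer_instance
  infer_instance

variable (C : Type u) [Category.{v} C]

/-- The torsion subcategory `T_{tr_n}`: the simplicial objects `X` with `tr_n(X) ≅ 0`. -/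
def simpTorsion (n : ℕ) : ObjectProperty (SimplicialObject C) := fun X =>
  IsZero ((SimplicialObject.truncation n).obj X)

/-- The torsion-free subcategory `F_{tr_n}`: the simplicial objects `X` for which the unit
`X ⟶ Cosk_n(X)` of the adjunction `tr_n ⊣ cosk_n` is monic. The pair
`(simpTorsion C n, simpTorsionFree C n)` is the torsion theory `μ_{≥ n+1}`. -/
def simpTorsionFree [HasFiniteLimits C] (n : ℕ) : ObjectProperty (SimplicialObject C) := fun X =>
  Mono ((SimplicialObject.coskAdj (C := C) n).unit.app X)

end Simplicial

end SemiAb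

open SemiAb

/-! For `μ_{≥ n+1}`, factor the unit `X ⟶ cosk_n tr_n X` degreewise as a regular epimorphism
followed by a monomorphism. The image is torsion-free, being a subobject of a coskeleton; the kernel
is torsion, because the unit is invertible in degrees at most `n`. Orthogonality is the adjunction.
For `KER_r`, cut a proper complex at degree `r`: the torsion part keeps the kernel of `δ_r` there,
the quotient keeps its image.

Properness of `N(X)` is where exactness and protomodularity meet (`isProper_of_reflexive_graph`).
The differential is one leg of a reflexive graph restricted to the kernel of the other. The image of
the graph is a reflexive relation, hence an equivalence relation, hence the kernel pair of some `q`;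
the differential then maps by a regular epimorphism onto the kernel of `q`.

`N` preserves kernels but not cokernels for formal reasons. For a torsion sequence `K ⟶ X ⟶ Y`, the
map `X ⟶ Y` is invertible in degrees at most `n`, so up to degree `n + 1` its normalization is a
pullback of a regular epimorphism. Above that degree `N(Y)` vanishes: a simplex of `Y` of dimension
greater than `n` with zero faces is zero, so the differentials from degree `n + 1` on have trivial
kernel and compose to zero. -/

namespace SemiAb

/-! ### Kernels, cokernels and proper morphisms. -/

section Exactness

variable {A : Type u} [Category.{v} A] [HasZeroMorphisms A]

/-- `k` is a kernel of `p`, in terms of generalized elements. -/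
structure IsKer {K X Y : A} (k : K ⟶ X) (p : X ⟶ Y) : Prop where
  mono : Mono k
  w : k ≫ p = 0
  exists_lift {Z : A} (x : Z ⟶ X) (_ : x ≫ p = 0) : ∃ l : Z ⟶ K, l ≫ k = x

/-- `p` is a cokernel of `k`. -/
structure IsCoker {K X Y : A} (k : K ⟶ X) (p : X ⟶ Y) : Prop where
  epi : Epi p
  w : k ≫ p = 0
  exists_desc {Z : A} (x : X ⟶ Z) (_ : k ≫ x = 0) : ∃ l : Y ⟶ Z, p ≫ l = x

variable {K X Y : A} {k : K ⟶ X} {p : X ⟶ Y}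

theorem IsKer.isLimit (h : IsKer k p) : Nonempty (IsLimit (KernelFork.ofι k h.w)) :=
  have := h.mono
  ⟨KernelFork.IsLimit.ofι' k h.w fun x hx => ⟨_, (h.exists_lift x hx).choose_spec⟩⟩

theorem IsKer.of_isLimit {w : k ≫ p = 0} (h : IsLimit (KernelFork.ofι k w)) : IsKer k p where
  mono := mono_of_isLimit_fork h
  w := w
  exists_lift x hx := ⟨_, (KernelFork.IsLimit.lift' h x hx).2⟩

theorem IsKer.kernel_ι (p : X ⟶ Y) [HasKernel p] : IsKer (kernel.ι p) p :=
  IsKer.of_isLimit (w := kernel.condition p) (kernelIsKernel p)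

theorem IsCoker.isColimit (h : IsCoker k p) : Nonempty (IsColimit (CokernelCofork.ofπ p h.w)) :=
  have := h.epi
  ⟨CokernelCofork.IsColimit.ofπ' p h.w fun x hx => ⟨_, (h.exists_desc x hx).choose_spec⟩⟩

theorem IsCoker.of_isColimit {w : k ≫ p = 0} (h : IsColimit (CokernelCofork.ofπ p w)) :
    IsCoker k p where
  epi := epi_of_isColimit_cofork h
  w := w
  exists_desc x hx := ⟨_, (CokernelCofork.IsColimit.desc' h x hx).2⟩

theorem isShortExact_iff : IsShortExact k p ↔ IsKer k p ∧ IsCoker k p :=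
  ⟨fun ⟨_, ⟨h⟩, ⟨h'⟩⟩ => ⟨.of_isLimit h, .of_isColimit h'⟩,
    fun ⟨h, h'⟩ => ⟨h.w, h.isLimit, h'.isColimit⟩⟩

theorem IsKer.normalMono (h : IsKer k p) : Nonempty (NormalMono k) :=
  ⟨⟨_, p, h.w, h.isLimit.some⟩⟩

theorem IsCoker.normalEpi (h : IsCoker k p) : Nonempty (NormalEpi p) :=
  ⟨⟨_, k, h.w, h.isColimit.some⟩⟩

theorem isKer_of_normalMono (h : NormalMono k) : IsKer k h.g :=
  .of_isLimit h.isLimit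

theorem isCoker_of_normalEpi (h : NormalEpi p) : IsCoker h.g p :=
  .of_isColimit h.isColimit

/-- A normal epimorphism is the cokernel of its kernel. -/
theorem IsKer.isCoker (hk : IsKer k p) (h : NormalEpi p) : IsCoker k p where
  epi := (isCoker_of_normalEpi h).epi
  w := hk.w
  exists_desc x hx := (isCoker_of_normalEpi h).exists_desc x (by
    obtain ⟨l, hl⟩ := hk.exists_lift h.g h.w
    rw [← hl, Category.assoc, hx, comp_zero])

theorem isKer_zero_of_mono [Mono p] (hK : IsZero K) : IsKer (0 : K ⟶ X) p where
  mono := ⟨fun _ _ _ => hK.eq_of_tgt _ _⟩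
  w := zero_comp
  exists_lift x hx := ⟨0, by rw [zero_comp, ← cancel_mono p, hx, zero_comp]⟩

theorem isKer_id (Y : A) : IsKer (𝟙 X) (0 : X ⟶ Y) where
  mono := inferInstance
  w := comp_zero
  exists_lift x _ := ⟨x, Category.comp_id x⟩

theorem isCoker_id (K : A) : IsCoker (0 : K ⟶ X) (𝟙 X) where
  epi := inferInstance
  w := zero_comp
  exists_desc x _ := ⟨x, Category.id_comp x⟩

theorem isCoker_zero (hY : IsZero Y) : IsCoker (𝟙 X) (0 : X ⟶ Y) where
  epi := ⟨fun _ _ _ => hY.eq_of_src _ _⟩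
  w := comp_zero
  exists_desc x hx := ⟨0, by rw [comp_zero, ← hx, Category.id_comp]⟩

theorem IsKer.of_iso {K' X' Y' : A} {k' : K' ⟶ X'} {p' : X' ⟶ Y'} (h : IsKer k p)
    (a : K ≅ K') (b : X ≅ X') (c : Y ≅ Y') (hk : k ≫ b.hom = a.hom ≫ k')
    (hp : p ≫ c.hom = b.hom ≫ p') : IsKer k' p' where
  mono := by
    have := h.mono
    have e : k' = a.inv ≫ k ≫ b.hom := by rw [hk, a.inv_hom_id_assoc]
    rw [e]
    infer_instance
  w := by
    rw [← cancel_epi a.hom, ← Category.assoc, ← hk, Category.assoc, ← hp, ← Category.assoc, h.w]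
    simp
  exists_lift x hx := by
    obtain ⟨l, hl⟩ := h.exists_lift (x ≫ b.inv) (by
      rw [← cancel_mono c.hom, Category.assoc, Category.assoc, hp, b.inv_hom_id_assoc, hx,
        zero_comp])
    exact ⟨l ≫ a.hom, by rw [Category.assoc, ← hk, ← Category.assoc, hl, Category.assoc,
      b.inv_hom_id, Category.comp_id]⟩

theorem IsCoker.of_iso {K' X' Y' : A} {k' : K' ⟶ X'} {p' : X' ⟶ Y'} (h : IsCoker k p)
    (a : K ≅ K') (b : X ≅ X') (c : Y ≅ Y') (hk : k ≫ b.hom = a.hom ≫ k')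
    (hp : p ≫ c.hom = b.hom ≫ p') : IsCoker k' p' where
  epi := by
    have := h.epi
    have e : p' = b.inv ≫ p ≫ c.hom := by rw [hp, b.inv_hom_id_assoc]
    rw [e]
    infer_instance
  w := by
    rw [← cancel_epi a.hom, ← Category.assoc, ← hk, Category.assoc, ← hp, ← Category.assoc, h.w]
    simp
  exists_desc x hx := by
    obtain ⟨l, hl⟩ := h.exists_desc (b.hom ≫ x) (by
      rw [← Category.assoc, hk, Category.assoc, hx, comp_zero])
    exact ⟨c.inv ≫ l, by rw [← cancel_epi b.hom, ← Category.assoc, ← hp, Category.assoc,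
      c.hom_inv_id_assoc, hl]⟩

theorem IsProper.of_iso {X' Y' : A} {f : X ⟶ Y} {f' : X' ⟶ Y'} (h : IsProper f)
    (a : X ≅ X') (b : Y ≅ Y') (w : f ≫ b.hom = a.hom ≫ f') : IsProper f' := by
  obtain ⟨I, e, m, ⟨he⟩, ⟨hm⟩, rfl⟩ := h
  refine ⟨I, a.inv ≫ e, m ≫ b.hom, ?_, ?_, ?_⟩
  · exact ((isCoker_of_normalEpi he).of_iso (.refl _) a (.refl _) (k' := he.g ≫ a.hom) (by simp)
      (by simp)).normalEpi
  · exact ((isKer_of_normalMono hm).of_iso (.refl _) b (.refl _) (p' := b.inv ≫ hm.g) (by simp)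
      (by simp)).normalMono
  · rw [← cancel_epi a.hom, ← w]
    simp

theorem IsKer.isIso_of_isZero (h : IsKer k p) (hY : IsZero Y) : IsIso k := by
  have := h.mono
  obtain ⟨l, hl⟩ := h.exists_lift (𝟙 X) (hY.eq_of_tgt _ _)
  exact ⟨l, by rw [← cancel_mono k, Category.assoc, hl]; simp, hl⟩

theorem IsCoker.isIso_of_isZero (h : IsCoker k p) (hK : IsZero K) : IsIso p := by
  have := h.epi
  obtain ⟨l, hl⟩ := h.exists_desc (𝟙 X) (hK.eq_of_src _ _)
  exact ⟨l, hl, by rw [← cancel_epi p, ← Category.assoc, hl]; simp⟩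

/-- The monic part `m` of `g ≫ k` factors through the kernel `k` because `e` is epic, and the factor
is the kernel of `k ≫ hm.g`. -/
theorem IsProper.of_comp_isKer {Z : A} {g : Z ⟶ K} (h : IsProper (g ≫ k)) (hk : IsKer k p) :
    IsProper g := by
  obtain ⟨I, e, m, ⟨he⟩, ⟨hm⟩, fac⟩ := h
  have := (isCoker_of_normalEpi he).epi
  have := hk.mono
  have hm' := isKer_of_normalMono hm
  obtain ⟨l, hl⟩ := hk.exists_lift m (by
    rw [← cancel_epi e, reassoc_of% fac, hk.w]
    simp)
  refine ⟨I, e, l, ⟨he⟩, IsKer.normalMono (p := k ≫ hm.g) ⟨?_, ?_, fun x hx => ?_⟩, ?_⟩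
  · have := hm'.mono
    exact mono_of_mono_fac hl
  · rw [reassoc_of% hl, hm'.w]
  · obtain ⟨y, hy⟩ := hm'.exists_lift (x ≫ k) (by rw [Category.assoc, hx])
    exact ⟨y, by rw [← cancel_mono k, Category.assoc, hl, hy]⟩
  · rw [← cancel_mono k, Category.assoc, hl, fac]

/-- The epic part is a cokernel of a map killed by `f`, hence of zero, so it is invertible. -/
theorem IsProper.normalMono_of_eq_zero {f : X ⟶ Y} (h : IsProper f)
    (hf : ∀ {Z : A} (x : Z ⟶ X), x ≫ f = 0 → x = 0) : Nonempty (NormalMono f) := by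
  obtain ⟨I, e, m, ⟨he⟩, ⟨hm⟩, rfl⟩ := h
  have hg : he.g = 0 := hf _ (by rw [← Category.assoc, he.w, zero_comp])
  have := (isCoker_of_normalEpi he).epi
  obtain ⟨l, hl⟩ := (isCoker_of_normalEpi he).exists_desc (𝟙 X) (by rw [hg, zero_comp])
  have hl' : l ≫ e = 𝟙 I := by rw [← cancel_epi e, ← Category.assoc, hl]; simp
  exact ((isKer_of_normalMono hm).of_iso ⟨l, e, hl', hl⟩ (.refl _) (.refl _) (k' := e ≫ m) (p' := hm.g)
    (by simp [reassoc_of% hl']) (by simp)).normalMono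

theorem isProper_of_normalMono {f : X ⟶ Y} (h : Nonempty (NormalMono f)) :
    IsProper f :=
  ⟨X, 𝟙 X, f, (isCoker_id X).normalEpi, h, Category.id_comp f⟩

theorem isProper_of_isZero_src (hX : IsZero X) (f : X ⟶ Y) : IsProper f := by
  obtain rfl := hX.eq_of_src f 0
  exact isProper_of_normalMono (isKer_zero_of_mono (p := 𝟙 Y) hX).normalMono

theorem isProper_of_isZero_tgt (hY : IsZero Y) (f : X ⟶ Y) : IsProper f := by
  obtain rfl := hY.eq_of_tgt f 0
  exact ⟨Y, 0, 𝟙 Y, (isCoker_zero hY).normalEpi, (isKer_id Y).normalMono, by simp⟩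

end Exactness

/-! ### Consequences of protomodularity and exactness. -/

section Protomodular

open scoped ZeroObject

variable {C : Type u} [Category.{v} C] [HasZeroMorphisms C]

/-- In a pointed protomodular category, the section and the kernel of a split epimorphism are
jointly strongly epic. -/
theorem Protomodular.isIso_of_mono [HasZeroObject C] [HasFiniteLimits C] [Protomodular C]
    {B X W : C} {p : X ⟶ B} {s : B ⟶ X} (hs : s ≫ p = 𝟙 B) (m : W ⟶ X) [Mono m]
    (σ : B ⟶ W) (hσ : σ ≫ m = s)
    (hk : ∀ {Z : C} (x : Z ⟶ X), x ≫ p = 0 → ∃ y : Z ⟶ W, y ≫ m = x) : IsIso m := by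
  obtain ⟨κ, hκ⟩ := hk (kernel.ι p) (kernel.condition p)
  -- Pulling a point back along `0 ⟶ B` gives its kernel. The points `W` and `X` over `B` share the
  -- kernel of `p`, so protomodularity applies to `m`.
  have key {V : C} (q : V ⟶ B) (k : kernel p ⟶ V) (g : V ⟶ X) (hg : g ≫ p = q) [Mono g]
      (hk : k ≫ g = kernel.ι p) : IsPullback k (0 : kernel p ⟶ (0 : C)) q 0 := by
    refine ⟨⟨by rw [← hg, reassoc_of% hk, kernel.condition, comp_zero]⟩,
      ⟨PullbackCone.IsLimit.mk _ (fun s => kernel.lift p (s.fst ≫ g) ?_) ?_ ?_ ?_⟩⟩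
    · rw [Category.assoc, hg, s.condition, comp_zero]
    · intro s
      rw [← cancel_mono g, Category.assoc, hk, kernel.lift_ι]
    · intro s
      exact (isZero_zero C).eq_of_tgt _ _
    · intro s l hl _
      rw [← cancel_mono (kernel.ι p), kernel.lift_ι, ← hl, Category.assoc, hk]
  exact Protomodular.isIso_of_pullback (0 : (0 : C) ⟶ B) (m ≫ p) σ
    (by rw [← Category.assoc, hσ, hs]) p s hs m rfl hσ κ 0 (key _ κ m rfl hκ) (kernel.ι p) 0
    (key _ _ (𝟙 X) (Category.id_comp _) (Category.comp_id _)) (𝟙 _)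
    (by rw [hκ, Category.id_comp]) (Category.id_comp _) inferInstance

variable [SemiAbelian C]

/-- In a semi-abelian category, every regular epimorphism is the cokernel of its kernel. -/
theorem IsKer.isCoker_of_isRegularEpi {K X Y : C} {k : K ⟶ X} {f : X ⟶ Y} (hk : IsKer k f)
    [IsRegularEpi f] : IsCoker k f where
  epi := inferInstance
  w := hk.w
  exists_desc {Z} g hg := by
    let r₁ := pullback.fst f f
    let r₂ := pullback.snd f f
    have h : r₁ ≫ g = r₂ ≫ g := by
      -- The equalizer contains the diagonal, which splits `r₁`, and the kernel of `r₁`: its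
      -- elements are pairs `(0, x)` with `x` in `K`, where `g` vanishes.
      have : IsIso (equalizer.ι (r₁ ≫ g) (r₂ ≫ g)) := by
        refine Protomodular.isIso_of_mono (p := r₁) (s := pullback.lift (𝟙 X) (𝟙 X) rfl)
          (pullback.lift_fst _ _ _) _ (equalizer.lift (pullback.lift (𝟙 X) (𝟙 X) rfl) ?_)
          (equalizer.lift_ι _ _) fun x hx => ⟨equalizer.lift x ?_, equalizer.lift_ι _ _⟩
        · simp [r₁, r₂, pullback.lift_fst_assoc, pullback.lift_snd_assoc]
        · obtain ⟨l, hl⟩ := hk.exists_lift (x ≫ r₂) (by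
            rw [Category.assoc, ← pullback.condition, reassoc_of% hx, zero_comp])
          rw [reassoc_of% hx, ← Category.assoc, ← hl, Category.assoc, hg]
          simp
      exact eq_of_epi_equalizer
    have hq := (IsKernelPair.of_hasPullback f).toCoequalizer (IsRegularEpi.getStruct f)
    exact ⟨_, (Cofork.IsColimit.desc' hq g h).2⟩

/-- In a semi-abelian category, every reflexive relation is an equivalence relation. -/
theorem isEquivalenceRelation_of_reflexive {S Y : C} (p₁ p₂ : S ⟶ Y) [JointlyMono₂ p₁ p₂]
    (r : Y ⟶ S) (hr₁ : r ≫ p₁ = 𝟙 Y) (hr₂ : r ≫ p₂ = 𝟙 Y) : IsEquivalenceRelation p₁ p₂ := by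
  let t₁ := pullback.fst p₁ p₁
  let t₂ := pullback.snd p₁ p₁
  have ht : t₁ ≫ p₁ = t₂ ≫ p₁ := pullback.condition
  have : Mono (prod.lift p₁ p₂) := ⟨fun a b h => JointlyMono₂.right_cancellation (p₁ := p₁)
    (p₂ := p₂) a b (by simpa [prod.lift_fst, prod.lift_snd] using h =≫ prod.fst) (by simpa [prod.lift_fst, prod.lift_snd] using h =≫ prod.snd)⟩
  -- The pairs `(x S y, x S z)` for which `y S z`. They include the diagonal by reflexivity and the
  -- kernel of `t₁` trivially (there `x = y = 0`). Invertibility of `m` says that `S` is Euclidean;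
  -- with reflexivity this yields symmetry, then transitivity.
  let m := pullback.fst (prod.lift (t₁ ≫ p₂) (t₂ ≫ p₂)) (prod.lift p₁ p₂)
  have : IsIso m := by
    refine Protomodular.isIso_of_mono (p := t₁) (s := pullback.lift (𝟙 S) (𝟙 S) rfl)
      (pullback.lift_fst _ _ _) m (pullback.lift _ (p₂ ≫ r) ?_) (pullback.lift_fst _ _ _)
      fun x hx => ⟨pullback.lift x (x ≫ t₂) ?_, pullback.lift_fst _ _ _⟩
    · ext <;> simp [t₁, t₂, hr₁, hr₂, prod.lift_fst, prod.lift_snd, pullback.lift_fst_assoc,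
        pullback.lift_snd_assoc]
    · ext
      · simp [← ht, reassoc_of% hx, prod.lift_fst]
      · simp [prod.lift_snd]
  let e := inv m ≫ pullback.snd (prod.lift (t₁ ≫ p₂) (t₂ ≫ p₂)) (prod.lift p₁ p₂)
  have he : e ≫ prod.lift p₁ p₂ = prod.lift (t₁ ≫ p₂) (t₂ ≫ p₂) := by
    rw [Category.assoc, ← pullback.condition, IsIso.inv_hom_id_assoc]
  have he₁ : e ≫ p₁ = t₁ ≫ p₂ := by simpa [prod.lift_fst, prod.lift_snd] using he =≫ prod.fst
  have he₂ : e ≫ p₂ = t₂ ≫ p₂ := by simpa [prod.lift_fst, prod.lift_snd] using he =≫ prod.snd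
  let s : S ⟶ S := pullback.lift (𝟙 S) (p₁ ≫ r) (by simp [hr₁]) ≫ e
  have hs₁ : s ≫ p₁ = p₂ := by simp [s, he₁, t₁, pullback.lift_fst_assoc]
  have hs₂ : s ≫ p₂ = p₁ := by simp [s, he₂, t₂, hr₂, pullback.lift_snd_assoc]
  refine ⟨⟨{
    right_cancellation := JointlyMono₂.right_cancellation
    r := r
    s := s
    reflexivity₁ := hr₁
    reflexivity₂ := hr₂
    symmetry₁ := hs₁
    symmetry₂ := hs₂
    c := pullback.cone p₂ p₁
    isLimit := pullback.isLimit p₂ p₁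
    t := pullback.lift (pullback.fst p₂ p₁ ≫ s) (pullback.snd p₂ p₁) ?_ ≫ e
    transitivity₁ := ?_
    transitivity₂ := ?_ }⟩⟩
  · rw [Category.assoc, hs₁, pullback.condition]
  · simp [he₁, t₁, hs₂, pullback.lift_fst_assoc]
  · simp [he₂, t₂, pullback.lift_snd_assoc]

theorem exists_fac_isRegularEpi_mono {X Y : C} (f : X ⟶ Y) :
    ∃ (I : C) (e : X ⟶ I) (m : I ⟶ Y), IsRegularEpi e ∧ Mono m ∧ e ≫ m = f :=
  let F := Regular.strongEpiMonoFactorisation f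
  ⟨F.I, F.e, F.m, inferInstanceAs (IsRegularEpi (Regular.strongEpiMonoFactorisation f).e),
    F.m_mono, F.fac⟩

/-- For a reflexive graph `(d, c)` in a semi-abelian category, the restriction of `c` to the kernel
of `d` is proper. -/
theorem isProper_of_reflexive_graph {R Y K : C} (d c : R ⟶ Y) (e : Y ⟶ R) (hd : e ≫ d = 𝟙 Y)
    (hc : e ≫ c = 𝟙 Y) (k : K ⟶ R) (hk : IsKer k d) : IsProper (k ≫ c) := by
  obtain ⟨S, ε, μ, _, _, hF⟩ := exists_fac_isRegularEpi_mono (prod.lift d c)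
  let p₁ := μ ≫ prod.fst
  let p₂ := μ ≫ prod.snd
  have h₁ : ε ≫ p₁ = d := by rw [reassoc_of% hF, prod.lift_fst]
  have h₂ : ε ≫ p₂ = c := by rw [reassoc_of% hF, prod.lift_snd]
  have : JointlyMono₂ p₁ p₂ := ⟨fun Z a b ha hb => by
    rw [← cancel_mono μ]
    ext
    · simpa [p₁] using ha
    · simpa [p₂] using hb⟩
  have := isEquivalenceRelation_of_reflexive p₁ p₂ (e ≫ ε) (by rw [Category.assoc, h₁, hd])
    (by rw [Category.assoc, h₂, hc])
  obtain ⟨Q, q, hq⟩ := BarrExact.exists_isKernelPair p₁ p₂ this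
  let l : K ⟶ kernel q := kernel.lift q (k ≫ c) (by
    rw [← h₂, Category.assoc, Category.assoc, ← hq.w, reassoc_of% h₁, reassoc_of% hk.w, zero_comp])
  let t : kernel q ⟶ S := hq.lift 0 (kernel.ι q) (by rw [zero_comp, kernel.condition])
  have ht₁ : t ≫ p₁ = 0 := hq.lift_fst _ _ _
  have ht₂ : t ≫ p₂ = kernel.ι q := hq.lift_snd _ _ _
  have := hk.mono
  -- `t` identifies the kernel of `q` with the pairs `(0, y)` in `S`, whose preimage under `ε` is
  -- the kernel of `d`. Thus `l` is a base change of `ε`.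
  have hsq : IsPullback k l ε t := by
    have hd' (s : PullbackCone ε t) : s.fst ≫ d = 0 := by
      rw [← h₁, ← Category.assoc, s.condition, Category.assoc, ht₁, comp_zero]
    choose u hu using fun s : PullbackCone ε t => hk.exists_lift s.fst (hd' s)
    refine ⟨⟨?_⟩, ⟨PullbackCone.IsLimit.mk _ u hu (fun s => ?_) fun s m hm _ => ?_⟩⟩
    · apply hq.hom_ext
      · simp [h₁, ht₁, hk.w]
      · simp [h₂, ht₂, l]
    · rw [← cancel_mono (kernel.ι q), Category.assoc, kernel.lift_ι, ← Category.assoc, hu, ← h₂,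
        ← Category.assoc, s.condition, Category.assoc, ht₂]
    · rw [← cancel_mono k, hm, hu]
  have : IsRegularEpi l :=
    Regular.regularEpiIsStableUnderBaseChange.of_isPullback hsq ‹IsRegularEpi ε›
  exact ⟨_, l, kernel.ι q, (IsKer.kernel_ι l).isCoker_of_isRegularEpi.normalEpi,
    (IsKer.kernel_ι q).normalMono, kernel.lift_ι _ _ _⟩

end Protomodular

/-! ### Images and cokernels in functor categories. -/

section FunctorCategory

universe v₁ u₁

variable {J : Type u₁} [Category.{v₁} J] {C : Type u} [Category.{v} C] [HasZeroMorphisms C]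

theorem IsCoker.of_app {K F G : J ⥤ C} {k : K ⟶ F} {p : F ⟶ G}
    (h : ∀ j, IsCoker (k.app j) (p.app j)) : IsCoker k p where
  epi := by
    have (j : J) := (h j).epi
    exact NatTrans.epi_of_epi_app p
  w := by
    ext j
    exact (h j).w
  exists_desc {Z} x hx := by
    choose l hl using fun j => (h j).exists_desc (x.app j) (by rw [← NatTrans.comp_app, hx]; rfl)
    refine ⟨⟨l, fun i j f => ?_⟩, ?_⟩
    · have := (h i).epi
      rw [← cancel_epi (p.app i), ← Category.assoc, ← p.naturality, Category.assoc, hl,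
        ← Category.assoc, hl, x.naturality]
    · ext j
      exact hl j

variable [SemiAbelian C]

/-- Natural transformations have pointwise (regular epi, mono)-factorizations. -/
theorem exists_fac_app_isRegularEpi_mono {F G : J ⥤ C} (α : F ⟶ G) :
    ∃ (I : J ⥤ C) (e : F ⟶ I) (m : I ⟶ G), (∀ j, IsRegularEpi (e.app j)) ∧ Mono m ∧
      e ≫ m = α := by
  choose I e m he hm fac using fun j => exists_fac_isRegularEpi_mono (α.app j)
  -- Diagonal fill-ins of these squares make the pointwise images functorial.
  have sq {i j : J} (f : i ⟶ j) : CommSq (F.map f ≫ e j) (e i) (m j) (m i ≫ G.map f) :=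
    ⟨by rw [Category.assoc, fac, α.naturality, ← Category.assoc, fac]⟩
  refine ⟨{
      obj := I
      map f := (sq f).lift
      map_id j := by rw [← cancel_mono (m j), (sq _).fac_right]; simp
      map_comp {i j k} f g := by
        rw [← cancel_mono (m k), (sq _).fac_right, Category.assoc, (sq _).fac_right,
          (sq f).fac_right_assoc]
        simp }, ⟨e, fun i j f => (sq f).fac_left.symm⟩, ⟨m, fun i j f => (sq f).fac_right⟩, he,
    @NatTrans.mono_of_mono_app _ _ _ _ _ _ _ hm, ?_⟩
  ext j
  exact fac j

variable {K F G : J ⥤ C} {k : K ⟶ F} {p : F ⟶ G}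

theorem IsKer.app (h : IsKer k p) (j : J) : IsKer (k.app j) (p.app j) :=
  .of_isLimit (w := by rw [← NatTrans.comp_app, h.w]; rfl)
    (KernelFork.mapIsLimit _ h.isLimit.some ((evaluation J C).obj j))

/-- Cokernels of natural transformations are pointwise regular epimorphisms. -/
theorem IsCoker.isRegularEpi_app (h : IsCoker k p) (j : J) : IsRegularEpi (p.app j) := by
  obtain ⟨I, e, m, he, hm, rfl⟩ := exists_fac_app_isRegularEpi_mono p
  -- The regular epic part also kills `k`, so it factors through the cokernel; the factor inverts
  -- `m`.
  obtain ⟨t, ht⟩ := h.exists_desc e (by rw [← cancel_mono m, Category.assoc, h.w, zero_comp])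
  have := h.epi
  have htm : t ≫ m = 𝟙 _ := by rw [← cancel_epi (e ≫ m), ← Category.assoc, ht, Category.comp_id]
  have hmt : m ≫ t = 𝟙 _ := by rw [← cancel_mono m, Category.assoc, htm]; simp
  have : IsIso (m.app j) := ⟨t.app j, by rw [← NatTrans.comp_app, hmt]; rfl,
    by rw [← NatTrans.comp_app, htm]; rfl⟩
  have := Regular.regularEpiIsStableUnderBaseChange (C := C)
  exact ((MorphismProperty.regularEpi C).cancel_right_of_respectsIso (e.app j) (m.app j)).2 (he j)

end FunctorCategory

/-! ### Coskeleta and the torsion theory `μ_{≥ n+1}`. -/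

variable {C : Type u} [Category.{v} C]


theorem simpTorsion_iff [HasZeroObject C] (n : ℕ) (X : SimplicialObject C) :
    simpTorsion C n X ↔ ∀ m ≤ n, IsZero (X _⦋m⦌) := by
  rw [simpTorsion, Functor.isZero_iff]
  exact ⟨fun h m hm => h (op ⟨⦋m⦌, hm⟩), fun h a => h _ a.unop.property⟩

section Coskeleton

variable [HasFiniteLimits C] (n : ℕ)

instance hasPointwiseRightKanExtension (Y : SimplicialObject.Truncated C n) :
    (SimplexCategory.Truncated.inclusion n).op.HasPointwiseRightKanExtension Y := fun X => by
  let _ : FinCategory (StructuredArrow X (SimplexCategory.Truncated.inclusion n).op) :=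
    { fintypeObj := Fintype.ofFinite _
      fintypeHom := fun _ _ => Fintype.ofFinite _ }
  infer_instance

/-- Generalized simplices of an `n`-coskeleton are determined by their faces of dimension at
most `n`. -/
theorem cosk_hom_ext (Y : SimplicialObject.Truncated C n) {Z : C} {m : ℕ}
    {x y : Z ⟶ ((SimplicialObject.Truncated.cosk n).obj Y) _⦋m⦌}
    (h : ∀ (j : ℕ) (_ : j ≤ n) (f : ⦋j⦌ ⟶ ⦋m⦌),
      x ≫ ((SimplicialObject.Truncated.cosk n).obj Y).map f.op =
        y ≫ ((SimplicialObject.Truncated.cosk n).obj Y).map f.op) : x = y := by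
  refine ((SimplexCategory.Truncated.inclusion n).op.isPointwiseRightKanExtensionRanCounit Y
    (op ⦋m⦌)).hom_ext fun ⟨_, j, f⟩ => ?_
  have := h j.unop.obj.len j.unop.property f.unop =≫
    (((SimplexCategory.Truncated.inclusion n).op.ranCounit.app Y).app j)
  rw [Category.assoc, Category.assoc] at this
  exact this

instance isIso_counit_coskAdj : IsIso (SimplicialObject.coskAdj (C := C) n).counit :=
  Functor.reflective' _

/-- The counit is invertible, so a triangle identity makes the truncated unit invertible. -/
theorem isIso_unit_app (X : SimplicialObject C) {m : ℕ} (hm : m ≤ n) :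
    IsIso (((SimplicialObject.coskAdj n).unit.app X).app (op ⦋m⦌)) := by
  have : IsIso ((SimplicialObject.truncation n).map
      ((SimplicialObject.coskAdj n).unit.app X)) := by
    have := (SimplicialObject.coskAdj n).left_triangle_components X
    have _ := IsIso.id ((SimplicialObject.truncation n).obj X)
    exact IsIso.of_isIso_fac_right this
  exact inferInstanceAs (IsIso (((SimplicialObject.truncation n).map
      ((SimplicialObject.coskAdj n).unit.app X)).app (op ⟨⦋m⦌, hm⟩)))

variable {n}

theorem simpTorsionFree_of_mono {X Y : SimplicialObject C} (f : X ⟶ Y) [Mono f]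
    (hY : simpTorsionFree C n Y) : simpTorsionFree C n X := by
  have : Mono ((SimplicialObject.coskAdj n).unit.app Y) := hY
  have h := (SimplicialObject.coskAdj n).unit.naturality f
  exact mono_of_mono_fac h.symm

theorem simpTorsionFree_cosk (Y : SimplicialObject.Truncated C n) :
    simpTorsionFree C n ((SimplicialObject.Truncated.cosk n).obj Y) := by
  have := (SimplicialObject.coskAdj n).right_triangle_components Y
  have := IsIso.of_isIso_fac_right this
  exact inferInstanceAs (Mono ((SimplicialObject.coskAdj n).unit.app _))

variable [HasZeroMorphisms C]

/-- Above dimension `n`, the generalized simplices of a torsion-free simplicial object are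
determined by their faces. -/
theorem simpTorsionFree.eq_zero {X : SimplicialObject C} (hX : simpTorsionFree C n X) {m : ℕ}
    (hm : n ≤ m) {Z : C} (x : Z ⟶ X _⦋m + 1⦌) (hx : ∀ i, x ≫ X.δ i = 0) : x = 0 := by
  have : Mono ((SimplicialObject.coskAdj n).unit.app X) := hX
  rw [← cancel_mono (((SimplicialObject.coskAdj n).unit.app X).app (op ⦋m + 1⦌)), zero_comp]
  refine cosk_hom_ext n _ fun j hj f => ?_
  -- As `j ≤ n < m + 1`, the map `f` misses a vertex and factors through a coface.
  have hf : ¬ Function.Surjective f.toOrderHom := fun hf => by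
    have : Epi f := SimplexCategory.epi_iff_surjective.2 hf
    have := SimplexCategory.len_le_of_epi f
    change m + 1 ≤ j at this
    lia
  obtain ⟨i, g, rfl⟩ := SimplexCategory.eq_comp_δ_of_not_surjective f hf
  have h := ((SimplicialObject.coskAdj n).unit.app X).naturality (SimplexCategory.δ i).op
  rw [op_comp, Functor.map_comp, zero_comp, Category.assoc, ← Category.assoc (NatTrans.app _ _)]
  erw [← h]
  erw [← Category.assoc, reassoc_of% (hx i)]
  rw [zero_comp]
  exact zero_comp

theorem simpTorsion.hom_eq_zero [HasZeroObject C] {X Y : SimplicialObject C} (f : X ⟶ Y)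
    (hX : simpTorsion C n X) (hY : simpTorsionFree C n Y) : f = 0 := by
  have : Mono ((SimplicialObject.coskAdj n).unit.app Y) := hY
  rw [← cancel_mono ((SimplicialObject.coskAdj n).unit.app Y)]
  apply ((SimplicialObject.coskAdj n).homEquiv _ _).symm.injective
  exact IsZero.eq_of_src hX _ _

end Coskeleton

/-- The torsion theory `μ_{≥ n+1}`. -/
theorem isTorsionTheory_simp [HasZeroMorphisms C] [SemiAbelian C] (n : ℕ) :
    IsTorsionTheory ⊤ (simpTorsion C n) (simpTorsionFree C n) where
  torsion_le := le_top
  torsionFree_le := le_top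
  torsion_replete := ⟨fun e h => IsZero.of_iso h ((SimplicialObject.truncation n).mapIso e.symm)⟩
  torsionFree_replete := ⟨fun e h => simpTorsionFree_of_mono e.inv h⟩
  eq_zero f hX hY := simpTorsion.hom_eq_zero f hX hY
  exists_sequence X _ := by
    obtain ⟨F, p, m, hp, hm, fac⟩ :=
      exists_fac_app_isRegularEpi_mono ((SimplicialObject.coskAdj n).unit.app X)
    have hk : IsKer (kernel.ι p) p := .kernel_ι p
    refine ⟨kernel p, F, kernel.ι p, p, (simpTorsion_iff n _).2 fun i hi => ?_,
      simpTorsionFree_of_mono m (simpTorsionFree_cosk _), isShortExact_iff.2 ⟨hk,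
        .of_app fun j => (hk.app j).isCoker_of_isRegularEpi⟩⟩
    have := isIso_unit_app n X hi
    have := (hk.app (op ⦋i⦌)).mono
    have h : kernel.ι p ≫ (SimplicialObject.coskAdj n).unit.app X = 0 := by
      rw [← fac, ← Category.assoc, kernel.condition, zero_comp]
    have h' : (kernel.ι p).app (op ⦋i⦌) = 0 := by
      rw [← cancel_mono (((SimplicialObject.coskAdj n).unit.app X).app (op ⦋i⦌)),
        ← NatTrans.comp_app, h, zero_comp]
      rfl
    exact (IsZero.iff_id_eq_zero _).2 (by rw [← cancel_mono ((kernel.ι p).app (op ⦋i⦌)), h']; simp)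

/-! ### Proper chain complexes and the torsion theory `KER r`. -/

section ChainComplexes

variable {C : Type u} [Category.{v} C] [HasZeroMorphisms C]

theorem IsKer.of_f {ι : Type*} {c : ComplexShape ι} {K M N : HomologicalComplex C c} {k : K ⟶ M}
    {p : M ⟶ N} (h : ∀ i, IsKer (k.f i) (p.f i)) : IsKer k p where
  mono := by
    have (i : ι) := (h i).mono
    exact HomologicalComplex.mono_of_mono_f k inferInstance
  w := by
    ext i
    exact (h i).w
  exists_lift {Z} x hx := by
    choose l hl using fun i => (h i).exists_lift (x.f i) (by
      rw [← HomologicalComplex.comp_f, hx]; rfl)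
    refine ⟨⟨l, fun i j _ => ?_⟩, ?_⟩
    · have := (h j).mono
      rw [← cancel_mono (k.f j), Category.assoc, ← k.comm, ← Category.assoc, hl, Category.assoc,
        hl, x.comm]
    · ext i
      exact hl i

theorem IsCoker.of_f {ι : Type*} {c : ComplexShape ι} {K M N : HomologicalComplex C c} {k : K ⟶ M}
    {p : M ⟶ N} (h : ∀ i, IsCoker (k.f i) (p.f i)) : IsCoker k p where
  epi := by
    have (i : ι) := (h i).epi
    exact HomologicalComplex.epi_of_epi_f p inferInstance
  w := by
    ext i
    exact (h i).w
  exists_desc {Z} x hx := by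
    choose l hl using fun i => (h i).exists_desc (x.f i) (by
      rw [← HomologicalComplex.comp_f, hx]; rfl)
    refine ⟨⟨l, fun i j _ => ?_⟩, ?_⟩
    · have := (h i).epi
      rw [← cancel_epi (p.f i), ← Category.assoc, hl, p.comm_assoc, hl, x.comm]
    · ext i
      exact hl i

theorem pch_of_iso {M N : ChainComplex C ℤ} (e : M ≅ N) (h : pch C M) : pch C N := fun i =>
  (h i).of_iso (HomologicalComplex.Hom.isoApp e i) (HomologicalComplex.Hom.isoApp e (i - 1))
    (e.hom.comm _ _).symm

/-- The torsion theory `KER r`. -/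
theorem isTorsionTheory_pch [HasKernels C] [HasZeroObject C] (r : ℤ) :
    IsTorsionTheory (pch C) (pchGE C r) (MN C r) where
  torsion_le _ h := h.1
  torsionFree_le _ h := h.1
  torsion_replete := ⟨fun e h => ⟨pch_of_iso e h.1, fun i hi =>
    (h.2 i hi).of_iso (HomologicalComplex.Hom.isoApp e.symm i)⟩⟩
  torsionFree_replete := ⟨fun e h => ⟨pch_of_iso e h.1,
    ((isKer_of_normalMono h.2.1.some).of_iso (HomologicalComplex.Hom.isoApp e r)
      (HomologicalComplex.Hom.isoApp e (r - 1)) (.refl _)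
      (p' := (HomologicalComplex.Hom.isoApp e (r - 1)).inv ≫ h.2.1.some.g)
      (e.hom.comm _ _).symm (by simp)).normalMono,
    fun i hi => (h.2.2 i hi).of_iso (HomologicalComplex.Hom.isoApp e.symm i)⟩⟩
  eq_zero {X Y} f hX hY := by
    ext i
    rcases lt_trichotomy i r with hi | rfl | hi
    · exact (hX.2 i hi).eq_of_src _ _
    · have := (isKer_of_normalMono hY.2.1.some).mono
      rw [← cancel_mono (Y.d i (i - 1)), f.comm, (hX.2 (i - 1) (by lia)).eq_of_tgt (X.d _ _) 0]
      simp
    · exact (hY.2.2 i hi).eq_of_tgt _ _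
  exists_sequence M hM := by
    -- In degree `r`, `p` is the epic part of `δ_r` and `m` its monic part.
    have key (i : ℤ) : ∃ (K Y : C) (k : K ⟶ M.X i) (p : M.X i ⟶ Y), IsKer k p ∧ IsCoker k p ∧
        (i < r → IsZero K) ∧ (r < i → IsZero Y) ∧
        (i = r → ∃ m : Y ⟶ M.X (i - 1), Nonempty (NormalMono m) ∧ p ≫ m = M.d i (i - 1)) := by
      have hz := isZero_zero C
      rcases lt_trichotomy i r with hi | hi | hi
      · exact ⟨_, _, 0, 𝟙 _, isKer_zero_of_mono hz, isCoker_id _, fun _ => hz, by lia, by lia⟩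
      · obtain ⟨I, e, m, ⟨he⟩, hm, fac⟩ := hM i
        exact ⟨_, _, kernel.ι e, e, .kernel_ι e, (IsKer.kernel_ι e).isCoker he, by lia, by lia,
          fun _ => ⟨m, hm, fac⟩⟩
      · exact ⟨_, _, 𝟙 _, 0, isKer_id _, isCoker_zero hz, by lia, fun _ => hz, by lia⟩
    choose K Y k p hk hp hK hY hr using key
    have hk' (i : ℤ) := (hk i).mono
    have hp' (i : ℤ) := (hp i).epi
    -- Only `i = r`, where `k` is a kernel of the epic part of `δ_r`, and `i = r + 1`, where `δ_r
    -- δ_{r+1} = 0` and `m` is monic, need an argument.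
    have hd (i j : ℤ) : k i ≫ M.d i j ≫ p j = 0 := by
      by_cases hij : j + 1 = i
      · obtain rfl : j = i - 1 := by lia
        rcases lt_trichotomy i r with hi | hi | hi
        · exact (hK i hi).eq_of_src _ _
        · obtain ⟨m, -, fac⟩ := hr i hi
          rw [← fac, Category.assoc, reassoc_of% (hk i).w, zero_comp]
        · rcases (show r ≤ i - 1 by lia).eq_or_lt' with hi' | hi'
          · obtain ⟨m, ⟨hm⟩, fac⟩ := hr (i - 1) hi'
            have := (isKer_of_normalMono hm).mono
            rw [← cancel_mono m, Category.assoc, Category.assoc, fac, M.d_comp_d]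
            simp
          · exact (hY _ hi').eq_of_tgt _ _
      · rw [M.shape i j hij, zero_comp, comp_zero]
    choose dT hT using fun i j => (hk j).exists_lift (k i ≫ M.d i j) (by
      rw [Category.assoc, hd])
    choose dF hF using fun i j => (hp i).exists_desc (M.d i j ≫ p j) (hd i j)
    let T : ChainComplex C ℤ :=
      { X := K
        d := dT
        shape i j hij := by rw [← cancel_mono (k j), hT, M.shape i j hij, comp_zero, zero_comp]
        d_comp_d' i j l _ _ := by
          rw [← cancel_mono (k l), Category.assoc, hT, reassoc_of% (hT i j), M.d_comp_d, comp_zero,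
            zero_comp] }
    let F : ChainComplex C ℤ :=
      { X := Y
        d := dF
        shape i j hij := by rw [← cancel_epi (p i), hF, M.shape i j hij, comp_zero, zero_comp]
        d_comp_d' i j l _ _ := by
          rw [← cancel_epi (p i), reassoc_of% (hF i j), hF, reassoc_of% (M.d_comp_d), comp_zero,
            zero_comp] }
    have hFr : Nonempty (NormalMono (F.d r (r - 1))) := by
      obtain ⟨m, ⟨hm⟩, fac⟩ := hr r rfl
      have := (hp (r - 1)).isIso_of_isZero (hK _ (by lia))
      have e : m ≫ p (r - 1) = F.d r (r - 1) := by
        rw [← cancel_epi (p r), hF, reassoc_of% fac]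
      exact ((isKer_of_normalMono hm).of_iso (.refl _) (asIso (p (r - 1))) (.refl _)
        (p' := inv (p (r - 1)) ≫ hm.g) (by simpa using e) (by simp)).normalMono
    refine ⟨T, F, ⟨k, fun i j _ => (hT i j).symm⟩, ⟨p, fun i j _ => hF i j⟩,
      ⟨fun i => ?_, hK⟩, ⟨fun i => ?_, hFr, hY⟩, isShortExact_iff.2 ⟨.of_f hk, .of_f hp⟩⟩
    · rcases lt_or_ge r i with hi | hi
      · have := (hk i).isIso_of_isZero (hY i hi)
        exact ((hM i).of_iso (asIso (k i)).symm (.refl _) (f' := T.d i (i - 1) ≫ k (i - 1))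
          (by simp [T, hT])).of_comp_isKer (hk _)
      · exact isProper_of_isZero_tgt (hK _ (by lia)) _
    · rcases lt_trichotomy i r with hi | rfl | hi
      · have := (hp i).isIso_of_isZero (hK i hi)
        have := (hp (i - 1)).isIso_of_isZero (hK _ (by lia))
        exact (hM i).of_iso (asIso (p i)) (asIso (p (i - 1))) (hF _ _).symm
      · exact isProper_of_normalMono hFr
      · exact isProper_of_isZero_src (hY i hi) _

end ChainComplexes

variable {C : Type u} [Category.{v} C] [HasZeroMorphisms C]

/-! ### Exactness properties of the Moore normalization. -/

namespace Moore

section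

variable [HasFiniteLimits C]

theorem isZero_objX {X : SimplicialObject C} {m : ℕ} (h : IsZero (X _⦋m⦌)) :
    IsZero (objX X m : C) :=
  (IsZero.iff_id_eq_zero _).2 (by
    rw [← cancel_mono (objX X m).arrow]
    exact h.eq_of_tgt _ _)

/-- For a torsion-free simplicial object `X`, the differentials `N(X)_{m+1} ⟶ N(X)_m` with `n ≤ m`
have trivial kernel. -/
theorem eq_zero_of_comp_objD {n : ℕ} {X : SimplicialObject C} (hX : simpTorsionFree C n X) {m : ℕ}
    (hm : n ≤ m) {Z : C} (x : Z ⟶ (objX X (m + 1) : C)) (hx : x ≫ objD X m = 0) : x = 0 := by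
  rw [← cancel_mono (objX X (m + 1)).arrow, zero_comp]
  refine hX.eq_zero hm _ fun i => ?_
  induction i using Fin.lastCases with
  | last => rw [Category.assoc, ← objD_arrow, reassoc_of% hx, zero_comp]
  | cast i =>
    rw [Category.assoc]
    erw [objX_arrow_δ]
    exact comp_zero

/-- For `m ≥ n + 2` both differentials below degree `m` have trivial kernel, yet their composite is
zero. -/
theorem isZero_objX_of_simpTorsionFree {n : ℕ} {X : SimplicialObject C}
    (hX : simpTorsionFree C n X) {m : ℕ} (hm : n + 1 < m) : IsZero (objX X m : C) := by
  obtain ⟨m, rfl⟩ : ∃ l, m = l + 2 := ⟨m - 2, by lia⟩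
  exact (IsZero.iff_id_eq_zero _).2 (eq_zero_of_comp_objD hX (by lia) _
    (eq_zero_of_comp_objD hX (by lia) _ (by rw [Category.assoc, objD_comp_objD, comp_zero])))

/-- The Moore normalization preserves kernels. -/
theorem isKer_mapX {K X Y : SimplicialObject C} {k : K ⟶ X} {p : X ⟶ Y} {m : ℕ}
    (h : ∀ j, IsKer (k.app j) (p.app j)) : IsKer (mapX k m) (mapX p m) where
  mono := by
    have := (h (op ⦋m⦌)).mono
    exact mono_of_mono_fac (mapX_arrow k m)
  w := by
    rw [← cancel_mono (objX Y m).arrow, Category.assoc, mapX_arrow, ← Category.assoc, mapX_arrow,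
      Category.assoc, (h _).w, comp_zero, zero_comp]
  exists_lift {Z} x hx := by
    obtain ⟨l, hl⟩ := (h (op ⦋m⦌)).exists_lift (x ≫ (objX X m).arrow) (by
      rw [Category.assoc, ← mapX_arrow, reassoc_of% hx, zero_comp])
    have hf : (objX K m).Factors l := by
      cases m with
      | zero => exact Subobject.top_factors _
      | succ m =>
        refine objX_factors K l fun i => ?_
        have := (h (op ⦋m⦌)).mono
        have hn := SimplicialObject.δ_naturality k i.castSucc
        rw [← cancel_mono (k.app (op ⦋m⦌)), Category.assoc, hn, reassoc_of% hl]
        erw [objX_arrow_δ]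
        rw [comp_zero, zero_comp]
    refine ⟨(objX K m).factorThru l hf, ?_⟩
    rw [← cancel_mono (objX X m).arrow, Category.assoc, mapX_arrow, ← Category.assoc,
      Subobject.factorThru_arrow, hl]

/-- If `p : X ⟶ Y` is monic in dimension `m - 1`, then `N(p)_m` is a pullback of `p_m`. -/
theorem isPullback_mapX {X Y : SimplicialObject C} (p : X ⟶ Y) (m : ℕ)
    (h : ∀ l < m, Mono (p.app (op ⦋l⦌))) :
    IsPullback (objX X m).arrow (mapX p m) (p.app (op ⦋m⦌)) (objX Y m).arrow := by
  have hf (s : PullbackCone (p.app (op ⦋m⦌)) (objX Y m).arrow) : (objX X m).Factors s.fst := by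
    cases m with
    | zero => exact Subobject.top_factors _
    | succ m =>
      refine objX_factors X _ fun i => ?_
      have := h m m.lt_succ_self
      have hn := SimplicialObject.δ_naturality p i.castSucc
      rw [← cancel_mono (p.app (op ⦋m⦌)), Category.assoc, hn, reassoc_of% s.condition]
      erw [objX_arrow_δ]
      rw [comp_zero, zero_comp]
  refine ⟨⟨(mapX_arrow p m).symm⟩, ⟨PullbackCone.IsLimit.mk _
    (fun s => (objX X m).factorThru s.fst (hf s)) (fun s => Subobject.factorThru_arrow _ _ _)
    (fun s => ?_) fun s l hl _ => ?_⟩⟩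
  · rw [← cancel_mono (objX Y m).arrow, Category.assoc, mapX_arrow, ← Category.assoc,
      Subobject.factorThru_arrow, s.condition]
  · rw [← cancel_mono (objX X m).arrow, hl, Subobject.factorThru_arrow]

end

variable [SemiAbelian C]

/-- The differentials of the Moore complex are proper: `N(X)_{m+1} ⟶ N(X)_m` is the restriction to
the kernel of `d_m` of one leg of the reflexive graph `(d_m, d_{m+1}) : R ⟶ N(X)_m`, where `R` is
the intersection of the kernels of `d_0, …, d_{m-1} : X_{m+1} ⟶ X_m`. -/
theorem isProper_objD (X : SimplicialObject C) (m : ℕ) : IsProper (objD X m) := by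
  let R : Subobject (X _⦋m + 1⦌) :=
    Finset.univ.inf fun i : Fin m => kernelSubobject (X.δ i.castSucc.castSucc)
  have hR (i : Fin m) : R.arrow ≫ X.δ i.castSucc.castSucc = 0 := by
    rw [← Subobject.factorThru_arrow _ _ (Subobject.finset_inf_arrow_factors Finset.univ
      (fun i : Fin m => kernelSubobject (X.δ i.castSucc.castSucc)) i (by simp)), Category.assoc,
      kernelSubobject_arrow_comp, comp_zero]
  have hR' {Z : C} (x : Z ⟶ X _⦋m + 1⦌) (hx : ∀ i : Fin m, x ≫ X.δ i.castSucc.castSucc = 0) :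
      R.Factors x :=
    (Subobject.finset_inf_factors _).2 fun i _ => kernelSubobject_factors _ _ (hx i)
  have hd : (objX X m).Factors (R.arrow ≫ X.δ (Fin.last m).castSucc) := by
    cases m with
    | zero => exact Subobject.top_factors _
    | succ m =>
      refine objX_factors X _ fun i => ?_
      have h := X.δ_comp_δ (i := i.castSucc) (j := (Fin.last m).castSucc)
        (Fin.castSucc_le_castSucc_iff.2 (Fin.le_last i))
      rw [Fin.succ_castSucc, Fin.succ_last] at h
      rw [Category.assoc, h, reassoc_of% (hR i), zero_comp]
  have hc : (objX X m).Factors (R.arrow ≫ X.δ (Fin.last (m + 1))) := by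
    cases m with
    | zero => exact Subobject.top_factors _
    | succ m =>
      refine objX_factors X _ fun i => ?_
      rw [Category.assoc, ← Fin.succ_last, X.δ_comp_δ (Fin.le_last _), reassoc_of% (hR i),
        zero_comp]
  -- The degeneracy `σ_m` is the common section of both legs.
  have he : R.Factors ((objX X m).arrow ≫ X.σ (Fin.last m)) := by
    refine hR' _ fun i => ?_
    cases m with
    | zero => exact i.elim0
    | succ m =>
      have h := X.δ_comp_σ_of_le (i := i.castSucc) (j := Fin.last m)
        (Fin.castSucc_le_castSucc_iff.2 (Fin.le_last i))
      rw [Fin.succ_last] at h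
      rw [Category.assoc, h, ← Category.assoc]
      erw [objX_arrow_δ]
      exact zero_comp
  have hk : R.Factors (objX X (m + 1)).arrow := hR' _ fun i => objX_arrow_δ X m i.castSucc
  have hfac : R.factorThru _ hk ≫ (objX X m).factorThru _ hc = objD X m := by
    rw [← cancel_mono (objX X m).arrow, Category.assoc, Subobject.factorThru_arrow,
      Subobject.factorThru_arrow_assoc, objD_arrow]
  rw [← hfac]
  refine isProper_of_reflexive_graph ((objX X m).factorThru _ hd) _ (R.factorThru _ he) ?_ ?_ _
    ⟨?_, ?_, fun x hx => ?_⟩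
  · rw [← cancel_mono (objX X m).arrow, Category.assoc, Subobject.factorThru_arrow,
      Subobject.factorThru_arrow_assoc, Category.assoc, X.δ_comp_σ_self]
    simp
  · rw [← cancel_mono (objX X m).arrow, Category.assoc, Subobject.factorThru_arrow,
      Subobject.factorThru_arrow_assoc, Category.assoc, ← Fin.succ_last, X.δ_comp_σ_succ]
    simp
  · exact mono_of_mono_fac (R.factorThru_arrow _ hk)
  · rw [← cancel_mono (objX X m).arrow, Category.assoc, Subobject.factorThru_arrow,
      Subobject.factorThru_arrow_assoc, zero_comp]
    exact objX_arrow_δ X m (Fin.last m)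
  · have hx' : (objX X (m + 1)).Factors (x ≫ R.arrow) := by
      refine objX_factors X _ fun i => ?_
      induction i using Fin.lastCases with
      | last =>
        rw [Category.assoc, ← (objX X m).factorThru_arrow _ hd, reassoc_of% hx, zero_comp]
      | cast i => rw [Category.assoc, hR, comp_zero]
    exact ⟨_, by rw [← cancel_mono R.arrow, Category.assoc, Subobject.factorThru_arrow,
      (objX X (m + 1)).factorThru_arrow _ hx']⟩

/-- The Moore normalization turns the short exact sequences of `μ_{≥ n+1}` into degreewise short
exact sequences. -/
theorem isCoker_mapX {n : ℕ} {K X Y : SimplicialObject C} {k : K ⟶ X} {p : X ⟶ Y}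
    (h : IsTorsionSequence (simpTorsion C n) (simpTorsionFree C n) k p) (m : ℕ) :
    IsCoker (mapX k m) (mapX p m) := by
  obtain ⟨hk, hp⟩ := isShortExact_iff.1 h.shortExact
  have hker : IsKer (mapX k m) (mapX p m) := isKer_mapX hk.app
  have hreg := hp.isRegularEpi_app
  -- In the second case every `l < m` is at most `n`, so `K` vanishes there and `p` is invertible.
  rcases lt_or_ge (n + 1) m with hm | hm
  · have hz := isZero_objX_of_simpTorsionFree h.torsionFree hm
    have := hker.isIso_of_isZero hz
    exact ⟨⟨fun _ _ _ => hz.eq_of_src _ _⟩, hker.w, fun x hx => ⟨0, by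
      rw [← cancel_epi (mapX k m), hx]; simp⟩⟩
  · have : IsRegularEpi (mapX p m) :=
      Regular.regularEpiIsStableUnderBaseChange.of_isPullback (isPullback_mapX p m fun l hl =>
      have := hreg (op ⦋l⦌)
      have := (hk.app (op ⦋l⦌)).isCoker_of_isRegularEpi.isIso_of_isZero
        ((simpTorsion_iff n K).1 h.torsion l (by lia))
      inferInstance) (hreg _)
    exact hker.isCoker_of_isRegularEpi

end Moore

/-! ### Transfer to the `ℤ`-indexed Moore complex. -/

variable [SemiAbelian C]

theorem isZero_moore (X : SimplicialObject C) {i : ℤ} (hi : i < 0) :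
    IsZero (((moore C).obj X).X i) :=
  ((mooreNat C).obj X).isZero_extend_X natToInt i fun m => by
    simp only [natToInt]
    lia

/-- The identification of `N(X)_m` with the subobject `Moore.objX X m`. -/
noncomputable def mooreXIso (X : SimplicialObject C) (m : ℕ) :
    ((moore C).obj X).X m ≅ (Moore.objX X m : C) :=
  ((mooreNat C).obj X).extendXIso natToInt rfl

theorem mooreXIso_d (X : SimplicialObject C) (m : ℕ) :
    ((moore C).obj X).d (m + 1 : ℕ) m ≫ (mooreXIso X m).hom =
      (mooreXIso X (m + 1)).hom ≫ Moore.objD X m := by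
  have h := ((mooreNat C).obj X).extend_d_eq natToInt (i := m + 1) (j := m) rfl rfl
  have h' : ((mooreNat C).obj X).d (m + 1) m = Moore.objD X m :=
    ChainComplex.of_d (fun n => (Moore.objX X n : C)) _ _
  rw [h'] at h
  exact (Iso.eq_comp_inv _).1 (h.trans (Category.assoc _ _ _).symm)

theorem mooreXIso_map {X Y : SimplicialObject C} (f : X ⟶ Y) (m : ℕ) :
    ((moore C).map f).f m ≫ (mooreXIso Y m).hom = (mooreXIso X m).hom ≫ Moore.mapX f m := by
  have h := HomologicalComplex.extendMap_f ((mooreNat C).map f) natToInt (i := m) rfl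
  exact (Iso.eq_comp_inv _).1 (h.trans (Category.assoc _ _ _).symm)

theorem pch_moore (X : SimplicialObject C) : pch C ((moore C).obj X) := fun i => by
  rcases lt_or_ge 0 i with hi | hi
  · obtain ⟨m, rfl⟩ : ∃ m : ℕ, i = (m + 1 : ℕ) := ⟨(i - 1).toNat, by lia⟩
    rw [show ((m + 1 : ℕ) : ℤ) - 1 = m by lia]
    exact (Moore.isProper_objD X m).of_iso (mooreXIso X (m + 1)).symm (mooreXIso X m).symm (by
      simpa [Iso.eq_inv_comp, ← Category.assoc, Iso.comp_inv_eq] using (mooreXIso_d X m).symm)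
  · exact isProper_of_isZero_tgt (isZero_moore X (by lia)) _

theorem pchGE_moore {n : ℕ} {X : SimplicialObject C} (hX : simpTorsion C n X) :
    pchGE C (n + 1) ((moore C).obj X) := by
  refine ⟨pch_moore X, fun i hi => ?_⟩
  rcases lt_or_ge i 0 with h | h
  · exact isZero_moore X h
  · lift i to ℕ using h
    exact (Moore.isZero_objX ((simpTorsion_iff n X).1 hX i (by lia))).of_iso (mooreXIso X i)

theorem MN_moore {n : ℕ} {X : SimplicialObject C} (hX : simpTorsionFree C n X) :
    MN C (n + 1) ((moore C).obj X) := by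
  refine ⟨pch_moore X, (pch_moore X _).normalMono_of_eq_zero fun {Z} x hx => ?_, fun i hi => ?_⟩
  -- The degrees `n + 1` and `n + 1 - 1` in `ℤ` are only propositionally casts of naturals, hence
  -- the variables `j` and `l`.
  · have key (j l : ℤ) (hj : j = (n + 1 : ℕ)) (hl : l = n) (x : Z ⟶ ((moore C).obj X).X j)
        (hx : x ≫ ((moore C).obj X).d j l = 0) : x = 0 := by
      subst hj hl
      rw [← cancel_mono (mooreXIso X (n + 1)).hom, zero_comp]
      exact Moore.eq_zero_of_comp_objD hX le_rfl _ (by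
        rw [Category.assoc, ← mooreXIso_d, reassoc_of% hx, zero_comp])
    exact key _ _ (by simp) (by simp) x hx
  · lift i to ℕ using by lia
    exact (Moore.isZero_objX_of_simpTorsionFree hX (by lia)).of_iso (mooreXIso X i)

theorem isTorsionSequence_moore {n : ℕ} {K X Y : SimplicialObject C} {k : K ⟶ X} {p : X ⟶ Y}
    (h : IsTorsionSequence (simpTorsion C n) (simpTorsionFree C n) k p) :
    IsTorsionSequence (pchGE C (n + 1)) (MN C (n + 1)) ((moore C).map k) ((moore C).map p) := by
  have hk := (isShortExact_iff.1 h.shortExact).1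
  have key (i : ℤ) : IsKer (((moore C).map k).f i) (((moore C).map p).f i) ∧
      IsCoker (((moore C).map k).f i) (((moore C).map p).f i) := by
    rcases lt_or_ge i 0 with hi | hi
    · have hz (X : SimplicialObject C) := isZero_moore X hi
      exact ⟨⟨⟨fun _ _ _ => (hz _).eq_of_tgt _ _⟩, (hz _).eq_of_src _ _,
        fun _ _ => ⟨0, (hz _).eq_of_tgt _ _⟩⟩, ⟨⟨fun _ _ _ => (hz _).eq_of_src _ _⟩,
        (hz _).eq_of_src _ _, fun _ _ => ⟨0, (hz _).eq_of_src _ _⟩⟩⟩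
    · lift i to ℕ using hi
      have hc {X Y : SimplicialObject C} (f : X ⟶ Y) :
          Moore.mapX f i ≫ (mooreXIso Y i).symm.hom =
            (mooreXIso X i).symm.hom ≫ ((moore C).map f).f i := by
        simpa [Iso.eq_inv_comp, ← Category.assoc, Iso.comp_inv_eq] using (mooreXIso_map f i).symm
      exact ⟨(Moore.isKer_mapX hk.app).of_iso _ _ _ (hc k) (hc p),
        (Moore.isCoker_mapX h i).of_iso _ _ _ (hc k) (hc p)⟩
  exact ⟨pchGE_moore h.torsion, MN_moore h.torsionFree,
    isShortExact_iff.2 ⟨.of_f fun i => (key i).1, .of_f fun i => (key i).2⟩⟩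

end SemiAb

open SemiAb
theorem mainTheorem8 {C : Type u} [Category.{v} C] [HasZeroMorphisms C] [SemiAbelian C] (n : ℕ) :
    IsTorsionTheory ⊤ (simpTorsion C n) (simpTorsionFree C n) ∧
    IsTorsionTheory (pch C) (pchGE C (n + 1)) (MN C (n + 1)) ∧
    (∀ X : SimplicialObject C, pch C ((moore C).obj X)) ∧
    (∀ {K X Y : SimplicialObject C} (k : K ⟶ X) (p : X ⟶ Y),
      IsTorsionSequence (simpTorsion C n) (simpTorsionFree C n) k p →
        IsTorsionSequence (pchGE C (n + 1)) (MN C (n + 1))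
          ((moore C).map k) ((moore C).map p)) ∧
    (∀ X : SimplicialObject C, simpTorsion C n X → pchGE C (n + 1) ((moore C).obj X)) ∧
    (∀ X : SimplicialObject C, simpTorsionFree C n X → MN C (n + 1) ((moore C).obj X)) :=
  ⟨isTorsionTheory_simp n, isTorsionTheory_pch _, pch_moore,
    fun _ _ => isTorsionSequence_moore, fun _ => pchGE_moore, fun _ => MN_moore⟩
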